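/- Let $M=(m_{ij})$ be a $2\times 2$ integer matrix with $\det M\neq 0$, and let $m=|\det M|$. Let $G(M;e_1,e_2)$ be the commutative $2$-step digraph of $M$: its vertices are the elements of the quotient group $\mathbb{Z}^2/M\mathbb{Z}^2$, where $M\mathbb{Z}^2$ is the lattice generated by the columns of $M$, and each vertex $u$ is adjacent exactly to the vertices $u+e_1$ and $u+e_2$, where $e_1=(1,0)^\top$ and $e_2=(0,1)^\top$ (taken modulo $M\mathbb{Z}^2$). A digraph is called a circulant digraph if it is isomorphic, for some positive integer $n$ and some subset $A\subseteq\mathbb{Z}/n\mathbb{Z}$, to the digraph with vertex set $\mathbb{Z}/n\mathbb{Z}$ in which each $u$ is adjacent exactly to the vertices $u+a$ with $a\in A$ (here $0\in A$, giving loops, is allowed). Then $G(M;e_1,e_2)$ is a circulant digraph if and only if either $$\gcd(m_{11},m_{12},m_{21},m_{22})=1,$$ or $$\gcd(m_{11},m_{12},m_{21},m_{22})=2\quad\text{and}\quad m=2\gcd(m,\;m_{22}+m_{12},\;m_{11}+m_{21}).$$ -/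

import Mathlib

/-- The Cayley digraph of an additive abelian group `Γ` with respect to a set `A` of steps:
vertex `u` is adjacent to exactly the vertices `u + a` with `a ∈ A`. -/
def cayleyDigraph (Γ : Type*) [AddCommGroup Γ] (A : Set Γ) : Digraph Γ where
  Adj u v := ∃ a ∈ A, v = u + a

/-- Two digraphs are isomorphic: there is a bijection of the vertices that preserves and reflects
adjacency. -/
def DigraphIsomorphic {V W : Type*} (G : Digraph V) (H : Digraph W) : Prop :=
  ∃ f : V ≃ W, ∀ u v : V, G.Adj u v ↔ H.Adj (f u) (f v)

/-- The circulant digraph `G(n; A)`: its vertices are the integers modulo `n`, and `u` is adjacent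
to the vertices `u + a`, `a ∈ A`. The step `0` (a loop at every vertex) is allowed. -/
def circulantDigraph (n : ℕ) (A : Set (ZMod n)) : Digraph (ZMod n) :=
  cayleyDigraph (ZMod n) A

/-- A digraph is a circulant digraph if it is isomorphic to `G(n; A)` for some positive integer `n`
and some set `A` of integers modulo `n`. -/
def IsCirculantDigraph {V : Type*} (G : Digraph V) : Prop :=
  ∃ n : ℕ, 0 < n ∧ ∃ A : Set (ZMod n), DigraphIsomorphic G (circulantDigraph n A)

/-- The lattice `M ℤⁿ` of the integral linear combinations of the columns of `M`. -/
def columnLattice {n : ℕ} (M : Matrix (Fin n) (Fin n) ℤ) : Submodule ℤ (Fin n → ℤ) :=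
  LinearMap.range M.mulVecLin

/-- The group `ℤⁿ / M ℤⁿ` of integral vectors modulo `M`. -/
abbrev VectorsMod {n : ℕ} (M : Matrix (Fin n) (Fin n) ℤ) : Type :=
  (Fin n → ℤ) ⧸ columnLattice M

/-- The class modulo `M` of the `i`-th unit vector. -/
def unitVectorMod {n : ℕ} (M : Matrix (Fin n) (Fin n) ℤ) (i : Fin n) : VectorsMod M :=
  (columnLattice M).mkQ (Pi.single i 1)

/-- The multidimensional circulant digraph `G(M; A)`: its vertices are the integral vectors modulo
`M`, and `u` is adjacent to the vertices `u + a`, `a ∈ A`. -/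
def multiCirculantDigraph {n : ℕ} (M : Matrix (Fin n) (Fin n) ℤ) (A : Set (VectorsMod M)) :
    Digraph (VectorsMod M) :=
  cayleyDigraph (VectorsMod M) A

/-- The commutative 2-step digraph `G(M; e₁, e₂)` of a `2 × 2` integer matrix `M`. -/
def commutativeTwoStepDigraph (M : Matrix (Fin 2) (Fin 2) ℤ) : Digraph (VectorsMod M) :=
  multiCirculantDigraph M {unitVectorMod M 0, unitVectorMod M 1}

/-- The first determinantal divisor of a `2 × 2` integer matrix: the greatest common divisor of its
four entries. -/
def entriesGcd (M : Matrix (Fin 2) (Fin 2) ℤ) : ℕ :=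
  Nat.gcd (Int.gcd (M 0 0) (M 0 1)) (Int.gcd (M 1 0) (M 1 1))

/-! Write `Γ` for `VectorsMod M`, `d` for the gcd of the entries and `t = e₂ - e₁`. The group `Γ` is
cyclic iff `d = 1`, and then the digraph is clearly circulant. If `2t ≠ 0`, the digraph determines
the group (`nonempty_addEquiv_of_cayley_equiv`), so circulant forces cyclic. If `t` has order 2, the
two steps form a coset of `{0, t}` and the digraph is always circulant
(`isCirculantDigraph_of_addOrderOf_sub_eq_two`). By Cramer's rule the order of `t` is `m / gcd(m,
m₂₂ + m₁₂, m₁₁ + m₂₁)`; since `d` divides that order, the noncyclic case has `d = 2`. -/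

/-! ### Isomorphisms of Cayley digraphs -/

theorem DigraphIsomorphic.cayley_of_addEquiv {Γ Γ' : Type*} [AddCommGroup Γ] [AddCommGroup Γ']
    (e : Γ ≃+ Γ') (A : Set Γ) :
    DigraphIsomorphic (cayleyDigraph Γ A) (cayleyDigraph Γ' (e '' A)) := by
  refine ⟨e.toEquiv, fun u v => ?_⟩
  simp only [cayleyDigraph, Set.exists_mem_image]
  refine exists_congr fun a => and_congr_right fun _ => ?_
  change _ ↔ e v = e u + e a
  rw [← map_add, e.injective.eq_iff]

theorem isCirculantDigraph_of_isAddCyclic {Γ : Type*} [AddCommGroup Γ] [Finite Γ]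
    [IsAddCyclic Γ] (A : Set Γ) : IsCirculantDigraph (cayleyDigraph Γ A) :=
  ⟨Nat.card Γ, Nat.card_pos, _,
    DigraphIsomorphic.cayley_of_addEquiv (zmodAddCyclicAddEquiv ‹IsAddCyclic Γ›).symm A⟩

theorem cayleyDigraph_fiber_adj {Γ Q : Type*} [AddCommGroup Γ] [AddCommGroup Q] (p : Γ →+ Q)
    (q : Q) (u v : Γ) : (cayleyDigraph Γ {a | p a = q}).Adj u v ↔ p v = p u + q := by
  constructor
  · rintro ⟨a, rfl, rfl⟩
    exact map_add p u a
  · intro h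
    exact ⟨v - u, by simp [h], by abel⟩

/-- Two Cayley digraphs whose steps form full fibres over a common quotient are isomorphic as soon
as the kernels have the same size. -/
theorem DigraphIsomorphic.cayley_of_fibers {Γ Γ' Q : Type*} [AddCommGroup Γ] [AddCommGroup Γ']
    [AddCommGroup Q] (p : Γ →+ Q) (p' : Γ' →+ Q) (hp : Function.Surjective p)
    (hp' : Function.Surjective p') (e : p.ker ≃ p'.ker) (q : Q) :
    DigraphIsomorphic (cayleyDigraph Γ {a | p a = q}) (cayleyDigraph Γ' {a | p' a = q}) := by
  -- Adjacency depends only on the images in `Q`, so any bijection respecting the fibres will do.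
  let F : ∀ c : Q, {a // p a = c} ≃ {b // p' b = c} := fun c =>
    ((p.fiberEquivKerOfSurjective hp c).trans e).trans (p'.fiberEquivKerOfSurjective hp' c).symm
  refine ⟨Equiv.ofFiberEquiv F, fun u v => ?_⟩
  have h := Equiv.ofFiberEquiv_map F
  rw [cayleyDigraph_fiber_adj, cayleyDigraph_fiber_adj, h, h]

/-- Rigidity: when `2a ≠ 2b`, the steps `a` and `b` stay distinguishable along the digraph, because
`u + a + b` is a common out-neighbour of `u + a` and `u + b`. Hence `f` is affine. -/
theorem nonempty_addEquiv_of_cayley_equiv {Γ Γ' : Type*} [AddCommGroup Γ] [AddCommGroup Γ']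
    {a b : Γ} {A : Set Γ'} (hgen : ∀ v : Γ, ∃ i j : ℕ, v = i • a + j • b)
    (hab : a + a ≠ b + b) (f : Γ ≃ Γ')
    (hf : ∀ u v, (cayleyDigraph Γ {a, b}).Adj u v ↔ (cayleyDigraph Γ' A).Adj (f u) (f v)) :
    Nonempty (Γ ≃+ Γ') := by
  have hne : a ≠ b := fun h => hab (by rw [h])
  have hf' : ∀ u v, (v = u + a ∨ v = u + b) ↔ ∃ x ∈ A, f v = f u + x := by
    intro u v
    exact Iff.trans (by simp [cayleyDigraph]) (hf u v)
  obtain ⟨c, hcA, hc⟩ := (hf' 0 (0 + a)).1 (Or.inl rfl)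
  obtain ⟨d, hdA, hd⟩ := (hf' 0 (0 + b)).1 (Or.inr rfl)
  have hA : ∀ x ∈ A, x = c ∨ x = d := by
    intro x hx
    rcases (hf' 0 (f.symm (f 0 + x))).2 ⟨x, hx, f.apply_symm_apply _⟩ with h | h
    · rw [Equiv.symm_apply_eq, hc] at h
      exact Or.inl (add_left_cancel h)
    · rw [Equiv.symm_apply_eq, hd] at h
      exact Or.inr (add_left_cancel h)
  have step : ∀ u v, (v = u + a ∨ v = u + b) ↔ (f v = f u + c ∨ f v = f u + d) := by
    intro u v
    rw [hf']
    constructor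
    · rintro ⟨x, hx, h⟩
      rcases hA x hx with rfl | rfl
      exacts [Or.inl h, Or.inr h]
    · rintro (h | h)
      exacts [⟨c, hcA, h⟩, ⟨d, hdA, h⟩]
  -- Otherwise `f a` and `f b` have the same out-neighbours, hence so do `a` and `b`.
  have hcd : c + c ≠ d + d := by
    intro h
    have h1 := (step (0 + a) (0 + a + a)).1 (Or.inl rfl)
    have h2 : f (0 + a + a) = f (0 + b) + c ∨ f (0 + a + a) = f (0 + b) + d := by
      rw [hc] at h1
      rw [hd]
      rcases h1 with h1 | h1
      · right; rw [h1, add_assoc, h, add_assoc]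
      · left; rw [h1]; abel
    rcases (step _ _).2 h2 with h3 | h3
    · exact hne (by simpa using h3)
    · exact hab (by simpa using h3)
  have key : ∀ u, f (u + a) = f u + c → f (u + b) = f u + d →
      f (u + a + b) = f u + c + d ∧ f (u + a + a) = f u + c + c ∧
        f (u + b + b) = f u + d + d := by
    intro u ha hb
    have h1 := (step (u + a) (u + a + b)).1 (Or.inr rfl)
    have h2 := (step (u + b) (u + a + b)).1 (Or.inl (by abel))
    have h3 := (step (u + a) (u + a + a)).1 (Or.inl rfl)
    have h4 := (step (u + b) (u + b + b)).1 (Or.inr rfl)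
    rw [ha] at h1 h3
    rw [hb] at h2 h4
    have hm : f (u + a + b) = f u + c + d := by
      rcases h1 with h1 | h1
      · rcases h2 with h2 | h2
        · rw [h2]; abel
        · exact absurd (h1.symm.trans h2) (by simpa [add_assoc] using hcd)
      · exact h1
    refine ⟨hm, h3.resolve_right fun h => hne ?_, h4.resolve_left fun h => hne ?_⟩
    · simpa [add_assoc] using f.injective (h.trans hm.symm)
    · have : f (u + b + b) = f (u + a + b) := by rw [h, hm]; abel
      simpa using (f.injective this).symm
  have main : ∀ i j : ℕ, f (i • a + j • b) = f 0 + i • c + j • d ∧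
      f (i • a + j • b + a) = f (i • a + j • b) + c ∧
      f (i • a + j • b + b) = f (i • a + j • b) + d := by
    intro i j
    induction i with
    | zero =>
      induction j with
      | zero => simpa using And.intro hc hd
      | succ j ih =>
        obtain ⟨h1, h2, h3⟩ := ih
        obtain ⟨k1, k2, k3⟩ := key _ h2 h3
        rw [succ_nsmul, ← add_assoc]
        refine ⟨by rw [h3, h1, succ_nsmul]; abel, ?_, by rw [k3, h3]⟩
        rw [add_right_comm, k1, h3]; abel
    | succ i ih =>
      obtain ⟨h1, h2, h3⟩ := ih
      obtain ⟨k1, k2, k3⟩ := key _ h2 h3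
      rw [succ_nsmul, add_right_comm]
      refine ⟨by rw [h2, h1, succ_nsmul]; abel, by rw [k2, h2], by rw [k1, h2]⟩
  refine ⟨⟨f.trans (Equiv.addRight (-f 0)), fun u v => ?_⟩⟩
  obtain ⟨i, j, rfl⟩ := hgen u
  obtain ⟨k, l, rfl⟩ := hgen v
  have : i • a + j • b + (k • a + l • b) = (i + k) • a + (j + l) • b := by
    rw [add_smul, add_smul]; abel
  change f _ + -f 0 = (f _ + -f 0) + (f _ + -f 0)
  rw [this, (main _ _).1, (main _ _).1, (main _ _).1, add_smul, add_smul]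
  abel

/-- Modulo `t = b - a` both steps agree, so the quotient is cyclic, of order `k` say. Then `ZMod (2
* k)` also maps onto it with kernel of order 2, and `cayley_of_fibers` applies. -/
theorem isCirculantDigraph_of_addOrderOf_sub_eq_two {Γ : Type*} [AddCommGroup Γ] [Finite Γ]
    {a b : Γ} (hgen : ∀ v : Γ, ∃ i j : ℕ, v = i • a + j • b) (hab : addOrderOf (b - a) = 2) :
    IsCirculantDigraph (cayleyDigraph Γ {a, b}) := by
  set t := b - a with ht
  have h2t : (2 : ℤ) • t = 0 := by
    rw [← addOrderOf_dvd_iff_zsmul_eq_zero, hab]; rfl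
  have hb : b = a + t := by rw [ht]; abel
  let p := QuotientAddGroup.mk' (AddSubgroup.zmultiples t)
  have hker : ∀ x, p x = 0 ↔ x = 0 ∨ x = t := by
    intro x
    rw [← AddMonoidHom.mem_ker, QuotientAddGroup.ker_mk', AddSubgroup.mem_zmultiples_iff]
    constructor
    · rintro ⟨k, rfl⟩
      obtain ⟨l, rfl | rfl⟩ := Int.even_or_odd' k
      · left; rw [mul_comm, mul_smul, h2t, smul_zero]
      · right; rw [add_smul, mul_comm, mul_smul, h2t, smul_zero, zero_add, one_smul]
    · rintro (rfl | rfl)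
      exacts [⟨0, zero_smul _ _⟩, ⟨1, one_smul _ _⟩]
  have hpt : p t = 0 := (hker t).2 (Or.inr rfl)
  set k := addOrderOf (p a) with hk
  have hkpos : 0 < k := addOrderOf_pos _
  have hlift : (zmultiplesHom _ (p a)) ((2 * k : ℕ) : ℤ) = 0 := by
    rw [zmultiplesHom_apply, ← addOrderOf_dvd_iff_zsmul_eq_zero, ← hk]
    push_cast
    exact dvd_mul_left _ _
  let p' : ZMod (2 * k) →+ (Γ ⧸ AddSubgroup.zmultiples t) := ZMod.lift (2 * k) ⟨_, hlift⟩
  have hp'z : ∀ z : ℤ, p' (z : ZMod (2 * k)) = z • p a := fun z => by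
    simp only [p', ZMod.lift_coe, zmultiplesHom_apply]
  have hp' : Function.Surjective p' := by
    intro q
    obtain ⟨v, rfl⟩ := QuotientAddGroup.mk'_surjective _ q
    obtain ⟨i, j, rfl⟩ := hgen v
    refine ⟨((i + j : ℕ) : ℤ), ?_⟩
    rw [hp'z]
    change _ = p _
    rw [hb, smul_add, map_add, map_add, map_nsmul, map_nsmul, map_nsmul, hpt, natCast_zsmul,
      add_smul, smul_zero, add_zero]
  have hker' : p'.ker = AddSubgroup.zmultiples ((k : ℤ) : ZMod (2 * k)) := by
    ext x
    obtain ⟨z, rfl⟩ := ZMod.intCast_surjective x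
    rw [AddMonoidHom.mem_ker, hp'z, ← addOrderOf_dvd_iff_zsmul_eq_zero, ← hk,
      AddSubgroup.mem_zmultiples_iff]
    constructor
    · rintro ⟨l, rfl⟩
      exact ⟨l, by push_cast; rw [zsmul_eq_mul]; ring⟩
    · rintro ⟨l, hl⟩
      rw [zsmul_eq_mul, ← Int.cast_mul, ZMod.intCast_eq_intCast_iff_dvd_sub] at hl
      have h1 : (k : ℤ) ∣ z - l * k := (Dvd.intro_left (2 : ℤ) (by push_cast; rfl)).trans hl
      exact (dvd_sub_left (dvd_mul_left _ _)).1 h1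
  have hcard : Nat.card p.ker = 2 := by
    rw [QuotientAddGroup.ker_mk', Nat.card_zmultiples, hab]
  have hcard' : Nat.card p'.ker = 2 := by
    rw [hker', Nat.card_zmultiples, Int.cast_natCast,
      ZMod.addOrderOf_coe k (by omega : 2 * k ≠ 0), Nat.gcd_eq_right (dvd_mul_left _ _),
      Nat.mul_div_cancel _ hkpos]
  have e : p.ker ≃ p'.ker := ((Nat.equivFinOfCardPos (by rw [hcard]; decide)).trans
    (finCongr (hcard.trans hcard'.symm))).trans (Nat.equivFinOfCardPos (by rw [hcard']; decide)).symm
  have hA : ({a, b} : Set Γ) = {x | p x = p a} := by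
    ext x
    rw [Set.mem_ofPred_eq, ← sub_eq_zero, ← map_sub, hker, sub_eq_zero, sub_eq_iff_eq_add', hb]
    rfl
  rw [hA]
  exact ⟨2 * k, by omega, _,
    DigraphIsomorphic.cayley_of_fibers p p' (QuotientAddGroup.mk'_surjective _) hp' e (p a)⟩

/-! ### The column lattice and its quotient -/

theorem mem_columnLattice_fin_two {M : Matrix (Fin 2) (Fin 2) ℤ} (hM : M.det ≠ 0)
    (v : Fin 2 → ℤ) :
    v ∈ columnLattice M ↔
      M.det ∣ M 1 1 * v 0 - M 0 1 * v 1 ∧ M.det ∣ M 0 0 * v 1 - M 1 0 * v 0 := by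
  rw [columnLattice, LinearMap.mem_range]
  constructor
  · rintro ⟨w, rfl⟩
    simp only [Matrix.mulVecLin_apply, Matrix.mulVec, dotProduct, Fin.sum_univ_two,
      Matrix.det_fin_two]
    exact ⟨⟨w 0, by ring⟩, ⟨w 1, by ring⟩⟩
  · rintro ⟨⟨x, hx⟩, ⟨y, hy⟩⟩
    refine ⟨![x, y], funext fun i => mul_left_cancel₀ hM ?_⟩
    have hdet := Matrix.det_fin_two M
    fin_cases i <;>
    simp only [Matrix.mulVecLin_apply, Matrix.mulVec, dotProduct, Fin.sum_univ_two, Fin.isValue,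
      Fin.zero_eta, Fin.mk_one, Matrix.cons_val_zero, Matrix.cons_val_one]
    · linear_combination (-M 0 0) * hx - M 0 1 * hy - v 0 * hdet
    · linear_combination (-M 1 0) * hx - M 1 1 * hy - v 1 * hdet

theorem entriesGcd_dvd (M : Matrix (Fin 2) (Fin 2) ℤ) (i j : Fin 2) :
    (entriesGcd M : ℤ) ∣ M i j := by
  rw [Int.natCast_dvd, entriesGcd]
  have h0 := Nat.gcd_dvd_left (Int.gcd (M 0 0) (M 0 1)) (Int.gcd (M 1 0) (M 1 1))
  have h1 := Nat.gcd_dvd_right (Int.gcd (M 0 0) (M 0 1)) (Int.gcd (M 1 0) (M 1 1))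
  fin_cases i <;> fin_cases j
  · exact h0.trans (Nat.gcd_dvd_left _ _)
  · exact h0.trans (Nat.gcd_dvd_right _ _)
  · exact h1.trans (Nat.gcd_dvd_left _ _)
  · exact h1.trans (Nat.gcd_dvd_right _ _)

theorem entriesGcd_dvd_of_mem_columnLattice {M : Matrix (Fin 2) (Fin 2) ℤ} {v : Fin 2 → ℤ}
    (hv : v ∈ columnLattice M) (i : Fin 2) : (entriesGcd M : ℤ) ∣ v i := by
  obtain ⟨w, rfl⟩ := LinearMap.mem_range.1 hv
  simp only [Matrix.mulVecLin_apply, Matrix.mulVec, dotProduct]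
  exact Finset.dvd_sum fun j _ => (entriesGcd_dvd M i j).mul_right _

theorem mem_columnLattice_of_det_dvd {M : Matrix (Fin 2) (Fin 2) ℤ} (hM : M.det ≠ 0)
    {v : Fin 2 → ℤ} (hv : ∀ i, M.det ∣ v i) : v ∈ columnLattice M :=
  (mem_columnLattice_fin_two hM v).2
    ⟨dvd_sub ((hv 0).mul_left _) ((hv 1).mul_left _),
      dvd_sub ((hv 1).mul_left _) ((hv 0).mul_left _)⟩

theorem finite_vectorsMod {M : Matrix (Fin 2) (Fin 2) ℤ} (hM : M.det ≠ 0) :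
    Finite (VectorsMod M) := by
  refine Module.finite_of_fg_torsion _ ?_
  intro x
  obtain ⟨v, rfl⟩ := (columnLattice M).mkQ_surjective x
  refine ⟨⟨M.det, mem_nonZeroDivisors_of_ne_zero hM⟩, ?_⟩
  change M.det • (columnLattice M).mkQ v = 0
  rw [← map_smul, Submodule.mkQ_apply, Submodule.Quotient.mk_eq_zero]
  exact mem_columnLattice_of_det_dvd hM fun i => dvd_mul_right _ _

theorem exists_nsmul_unitVectorMod {M : Matrix (Fin 2) (Fin 2) ℤ} (hM : M.det ≠ 0)
    (x : VectorsMod M) :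
    ∃ i j : ℕ, x = i • unitVectorMod M 0 + j • unitVectorMod M 1 := by
  obtain ⟨v, rfl⟩ := (columnLattice M).mkQ_surjective x
  refine ⟨(v 0 % M.det).toNat, (v 1 % M.det).toNat, ?_⟩
  rw [unitVectorMod, unitVectorMod, ← map_nsmul, ← map_nsmul, ← map_add, ← sub_eq_zero, ← map_sub,
    Submodule.mkQ_apply, Submodule.Quotient.mk_eq_zero]
  refine mem_columnLattice_of_det_dvd hM fun i => ?_
  fin_cases i <;>
    simpa [Int.toNat_of_nonneg (Int.emod_nonneg _ hM)] using Int.dvd_self_sub_emod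

theorem zsmul_unitVectorMod_sub_eq_zero {M : Matrix (Fin 2) (Fin 2) ℤ} (hM : M.det ≠ 0) (n : ℤ) :
    n • (unitVectorMod M 1 - unitVectorMod M 0) = 0 ↔
      M.det ∣ n * (M 1 1 + M 0 1) ∧ M.det ∣ n * (M 0 0 + M 1 0) := by
  rw [unitVectorMod, unitVectorMod, ← map_sub, ← map_zsmul, Submodule.mkQ_apply,
    Submodule.Quotient.mk_eq_zero, mem_columnLattice_fin_two hM]
  refine and_congr ?_ ?_
  · rw [← dvd_neg]
    refine iff_of_eq (congrArg _ ?_)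
    simp
    ring
  · refine iff_of_eq (congrArg _ ?_)
    simp
    ring

/-! ### Cyclicity of the quotient group -/

theorem entriesGcd_eq_one_of_isAddCyclic {M : Matrix (Fin 2) (Fin 2) ℤ}
    (h : IsAddCyclic (VectorsMod M)) : entriesGcd M = 1 := by
  obtain ⟨g, hg⟩ := h.exists_zsmul_surjective
  obtain ⟨w, rfl⟩ := (columnLattice M).mkQ_surjective g
  have key : ∀ v : Fin 2 → ℤ, ∃ k : ℤ, ∀ i, (entriesGcd M : ℤ) ∣ k * w i - v i := by
    intro v
    obtain ⟨k, hk⟩ := hg ((columnLattice M).mkQ v)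
    refine ⟨k, fun i => ?_⟩
    simp only at hk
    rw [← map_zsmul, ← sub_eq_zero, ← map_sub, Submodule.mkQ_apply,
      Submodule.Quotient.mk_eq_zero] at hk
    simpa using entriesGcd_dvd_of_mem_columnLattice hk i
  obtain ⟨k, hk⟩ := key ![1, 0]
  obtain ⟨l, hl⟩ := key ![0, 1]
  obtain ⟨p, hp⟩ := hk 0
  obtain ⟨q, hq⟩ := hk 1
  obtain ⟨r, hr⟩ := hl 0
  obtain ⟨s, hs⟩ := hl 1
  simp only [Matrix.cons_val_zero, Matrix.cons_val_one, Fin.isValue] at hp hq hr hs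
  -- Modulo the gcd, both unit vectors are multiples of `w`, so their determinant 1 vanishes.
  have : (entriesGcd M : ℤ) ∣ 1 :=
    ⟨q * (l * w 0) - p * (l * w 1) - s, by
      linear_combination (-(l * w 1)) * hp + (l * w 0) * hq - hs⟩
  exact Nat.dvd_one.1 (by exact_mod_cast this)

theorem exists_add_mul_coprime_mod (a b c d : ℤ) {n : ℕ} (hn : n ≠ 0)
    (h : ∀ p : ℕ, p.Prime → ¬ ((p : ℤ) ∣ a ∧ (p : ℤ) ∣ b ∧ (p : ℤ) ∣ c ∧ (p : ℤ) ∣ d)) :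
    ∃ k : ℤ, Int.gcd (Int.gcd (a + k * c) (b + k * d)) n = 1 := by
  classical
  set S : Finset ℕ := n.primeFactors.filter fun p => ¬ ((p : ℤ) ∣ a ∧ (p : ℤ) ∣ b) with hS
  -- `k` is the product of the primes of `n` not dividing both `a` and `b`: each prime of `n`
  -- divides exactly one of `k` and `gcd(a, b)`.
  refine ⟨((∏ p ∈ S, p : ℕ) : ℤ), Nat.coprime_of_dvd fun p hp h1 h2 => ?_⟩
  have hpn : p ∣ n := by simpa using h2
  have h1' : (p : ℤ) ∣ (Int.gcd (a + (∏ p ∈ S, p : ℕ) * c) (b + (∏ p ∈ S, p : ℕ) * d) : ℤ) := by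
    simpa using Int.natCast_dvd_natCast.2 h1
  have ha := h1'.trans (Int.gcd_dvd_left _ _)
  have hb := h1'.trans (Int.gcd_dvd_right _ _)
  have hpS : p ∈ S ↔ ¬ ((p : ℤ) ∣ a ∧ (p : ℤ) ∣ b) := by
    rw [hS, Finset.mem_filter, Nat.mem_primeFactors]
    exact and_iff_right ⟨hp, hpn, hn⟩
  by_cases hab : (p : ℤ) ∣ a ∧ (p : ℤ) ∣ b
  · have hk : ¬ (p : ℤ) ∣ ((∏ p ∈ S, p : ℕ) : ℤ) := by
      rw [Int.natCast_dvd_natCast, hp.prime.dvd_finsetProd_iff]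
      rintro ⟨q, hq, hpq⟩
      have hqp : q.Prime := Nat.prime_of_mem_primeFactors (Finset.mem_filter.1 hq).1
      rw [(Nat.prime_dvd_prime_iff_eq hp hqp).1 hpq] at hab
      exact (Finset.mem_filter.1 hq).2 hab
    have hpZ := Nat.prime_iff_prime_int.1 hp
    exact h p hp ⟨hab.1, hab.2, (hpZ.dvd_or_dvd ((dvd_add_right hab.1).1 ha)).resolve_left hk,
      (hpZ.dvd_or_dvd ((dvd_add_right hab.2).1 hb)).resolve_left hk⟩
  · have hk : (p : ℤ) ∣ ((∏ p ∈ S, p : ℕ) : ℤ) :=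
      Int.natCast_dvd_natCast.2 (Finset.dvd_prod_of_mem _ (hpS.2 hab))
    exact hab ⟨(dvd_add_left (hk.mul_right c)).1 ha, (dvd_add_left (hk.mul_right d)).1 hb⟩

/-- Some combination `R` = first row + `k` · second row of the adjugate is unimodular modulo `det
M`. A vector on which `R` takes the value 1 modulo `det M` generates. -/
theorem isAddCyclic_of_entriesGcd_eq_one {M : Matrix (Fin 2) (Fin 2) ℤ} (hM : M.det ≠ 0)
    (h : entriesGcd M = 1) : IsAddCyclic (VectorsMod M) := by
  obtain ⟨k, hk⟩ := exists_add_mul_coprime_mod (M 1 1) (-M 0 1) (-M 1 0) (M 0 0)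
    (Int.natAbs_ne_zero.2 hM) (by
      rintro p hp ⟨h1, h2, h3, h4⟩
      rw [dvd_neg] at h2 h3
      refine hp.one_lt.ne' (Nat.dvd_one.1 (h ▸ ?_))
      exact Nat.dvd_gcd (Int.dvd_gcd h4 h2) (Int.dvd_gcd h3 h1))
  obtain ⟨x, y, z, hxyz⟩ : ∃ x y z : ℤ,
      x * (M 1 1 + k * -M 1 0) + y * (-M 0 1 + k * M 0 0) + z * M.det = 1 := by
    obtain ⟨s, t, hst⟩ := Int.isCoprime_iff_gcd_eq_one.2 hk
    rw [Int.gcd_eq_gcd_ab] at hst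
    obtain ⟨e, he⟩ : M.det ∣ (M.det.natAbs : ℤ) := Int.dvd_natAbs.2 dvd_rfl
    rw [he] at hst
    refine ⟨s * Int.gcdA (M 1 1 + k * -M 1 0) (-M 0 1 + k * M 0 0),
      s * Int.gcdB (M 1 1 + k * -M 1 0) (-M 0 1 + k * M 0 0), t * e, ?_⟩
    linear_combination hst
  refine ⟨(columnLattice M).mkQ ![x, y], fun q => ?_⟩
  obtain ⟨v, rfl⟩ := (columnLattice M).mkQ_surjective q
  set r := (M 1 1 + k * -M 1 0) * v 0 + (-M 0 1 + k * M 0 0) * v 1 with hr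
  refine ⟨r, ?_⟩
  simp only
  symm
  rw [← map_zsmul, ← sub_eq_zero, ← map_sub, Submodule.mkQ_apply,
    Submodule.Quotient.mk_eq_zero, mem_columnLattice_fin_two hM]
  have hdet := Matrix.det_fin_two M
  obtain ⟨w, hw⟩ : ∃ w, v - r • ![x, y] = w := ⟨_, rfl⟩
  have hw0 : w 0 = v 0 - r * x := by rw [← hw]; simp
  have hw1 : w 1 = v 1 - r * y := by rw [← hw]; simp
  rw [hw]
  have hrow : (M 1 1 + k * -M 1 0) * w 0 + (-M 0 1 + k * M 0 0) * w 1 = M.det * (r * z) := by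
    rw [hw0, hw1]
    linear_combination -hr - r * hxyz
  -- The adjugate has determinant `det M` and `R` is unimodular, so modulo `det M` its second row is
  -- a multiple of `R`.
  have h2 : M.det ∣ M 0 0 * w 1 - M 1 0 * w 0 :=
    ⟨(x * -M 1 0 + y * M 0 0) * (r * z) + (-y * w 0 + x * w 1
      + z * (M 0 0 * w 1 - M 1 0 * w 0)), by
      linear_combination (x * -M 1 0 + y * M 0 0) * hrow
        - (M 0 0 * w 1 - M 1 0 * w 0) * hxyz - (-y * w 0 + x * w 1) * hdet⟩
  refine ⟨?_, h2⟩
  have : M 1 1 * w 0 - M 0 1 * w 1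
      = M.det * (r * z) - k * (M 0 0 * w 1 - M 1 0 * w 0) := by
    linear_combination hrow
  rw [this]
  exact dvd_sub (dvd_mul_right _ _) (h2.mul_left _)

theorem corollary3p6 (M : Matrix (Fin 2) (Fin 2) ℤ) (m : ℕ) (hM : M.det ≠ 0)
    (hm : m = M.det.natAbs) :
    IsCirculantDigraph (commutativeTwoStepDigraph M) ↔
      entriesGcd M = 1 ∨
        (entriesGcd M = 2 ∧
          m = 2 * Nat.gcd m (Int.gcd (M 1 1 + M 0 1) (M 0 0 + M 1 0))) := by
  have : Finite (VectorsMod M) := finite_vectorsMod hM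
  have hgen := exists_nsmul_unitVectorMod hM
  have hm0 : 0 < m := hm ▸ Int.natAbs_pos.2 hM
  have hdvd : ∀ z : ℤ, M.det ∣ z ↔ (m : ℤ) ∣ z := fun z => by rw [hm, Int.natAbs_dvd]
  have hsub := zsmul_unitVectorMod_sub_eq_zero hM
  simp only [hdvd] at hsub
  set G := Nat.gcd m (Int.gcd (M 1 1 + M 0 1) (M 0 0 + M 1 0)) with hG
  have hGm : G ∣ m := Nat.gcd_dvd_left _ _
  have hGs : (G : ℤ) ∣ M 1 1 + M 0 1 :=
    (Int.natCast_dvd_natCast.2 (Nat.gcd_dvd_right _ _)).trans (Int.gcd_dvd_left _ _)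
  have hGt : (G : ℤ) ∣ M 0 0 + M 1 0 :=
    (Int.natCast_dvd_natCast.2 (Nat.gcd_dvd_right _ _)).trans (Int.gcd_dvd_right _ _)
  constructor
  · rintro ⟨n, hn, A, f, hf⟩
    by_cases hcyc : IsAddCyclic (VectorsMod M)
    · exact Or.inl (entriesGcd_eq_one_of_isAddCyclic hcyc)
    have h1 : entriesGcd M ≠ 1 := fun h => hcyc (isAddCyclic_of_entriesGcd_eq_one hM h)
    have h2 : (2 : ℤ) • (unitVectorMod M 1 - unitVectorMod M 0) = 0 := by
      by_contra hne
      refine hcyc ?_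
      have hab : unitVectorMod M 0 + unitVectorMod M 0 ≠ unitVectorMod M 1 + unitVectorMod M 1 :=
        fun h => hne (by rw [smul_sub, two_zsmul, two_zsmul, h, sub_self])
      obtain ⟨e⟩ := nonempty_addEquiv_of_cayley_equiv hgen hab f hf
      exact isAddCyclic_of_surjective e.symm e.symm.surjective
    -- Lattice vectors have coordinates divisible by the gcd, and `n(e₂ - e₁)` has second coordinate
    -- `n`.
    have hone : ∀ n : ℤ, n • (unitVectorMod M 1 - unitVectorMod M 0) = 0 →
        (entriesGcd M : ℤ) ∣ n := by
      intro n h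
      rw [unitVectorMod, unitVectorMod, ← map_sub, ← map_zsmul, Submodule.mkQ_apply,
        Submodule.Quotient.mk_eq_zero] at h
      simpa using entriesGcd_dvd_of_mem_columnLattice h 1
    have hd2 : entriesGcd M = 2 :=
      ((Nat.dvd_prime Nat.prime_two).1 (by exact_mod_cast hone 2 h2)).resolve_left h1
    refine Or.inr ⟨hd2, ?_⟩
    have hmG : m ∣ 2 * G := by
      obtain ⟨h3, h4⟩ := (hsub 2).1 h2
      rw [hG, ← Nat.gcd_mul_left]
      refine Nat.dvd_gcd (dvd_mul_left _ _) ?_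
      have := Int.dvd_gcd h3 h4
      rwa [Int.gcd_mul_left] at this
    obtain ⟨q, hq⟩ := hGm
    have hG0 : 0 < G := Nat.pos_of_ne_zero fun h => by simp [h] at hq; omega
    have hq2 : q ∣ 2 := by
      rw [hq, mul_comm 2 G] at hmG
      exact Nat.dvd_of_mul_dvd_mul_left hG0 hmG
    rcases (Nat.dvd_prime Nat.prime_two).1 hq2 with rfl | rfl
    · rw [mul_one] at hq
      refine absurd (hone 1 ((hsub 1).2 ?_)) (by rw [hd2]; decide)
      rw [one_mul, one_mul, hq]
      exact ⟨hGs, hGt⟩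
    · rw [mul_comm, ← hq]
  · rintro (h | ⟨-, h⟩)
    · have := isAddCyclic_of_entriesGcd_eq_one hM h
      exact isCirculantDigraph_of_isAddCyclic _
    · refine isCirculantDigraph_of_addOrderOf_sub_eq_two hgen
        (addOrderOf_eq_prime ?_ fun h0 => ?_)
      · rw [← natCast_zsmul, hsub, h]
        push_cast
        exact ⟨mul_dvd_mul_left _ hGs, mul_dvd_mul_left _ hGt⟩
      · rw [← one_zsmul (_ - _), hsub, one_mul, one_mul] at h0
        have : m ∣ G := Nat.dvd_gcd dvd_rfl (Int.dvd_gcd h0.1 h0.2)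
        have := Nat.le_of_dvd (by omega) this
        omega
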